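/- Let $R=\mathbb{C}[[t]]$, $K=\mathbb{C}((t))$ and $R_n=\mathbb{C}[t]/(t^{n+1})=R/(t^{n+1})$. Let $X$ be a smooth projective variety over $\mathbb{C}$ and let $\mathcal{X}\to\mathrm{Spf}(R)$ be a formal deformation of $X$, that is, an inductive system of flat schemes $\pi_n:\mathcal{X}_n\to\mathrm{Spec}(R_n)$, $n\ge 0$, with isomorphisms $\mathcal{X}_{n+1}\times_{\mathrm{Spec}(R_{n+1})}\mathrm{Spec}(R_n)\cong\mathcal{X}_n$ over $R_n$ and $\mathcal{X}_0\cong X$ over $\mathbb{C}$; the formal scheme $\mathcal{X}$ is the topological space $X$ with the sheaf of rings $\mathcal{O}_{\mathcal{X}}=\varprojlim\mathcal{O}_{\mathcal{X}_n}$. Let $\mathrm{Coh}(\mathcal{X})$ be the $R$-linear abelian category of coherent $\mathcal{O}_{\mathcal{X}}$-modules, and let $\mathrm{Coh}(\mathcal{X})_0\subset\mathrm{Coh}(\mathcal{X})$ be the Serre subcategory of those $E$ with $t^{n+1}E=0$ for some $n\ge 0$. Let $\mathrm{Coh}(\mathcal{X}_K)=\mathrm{Coh}(\mathcal{X})/\mathrm{Coh}(\mathcal{X})_0$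 be the Serre quotient, that is, the localization of $\mathrm{Coh}(\mathcal{X})$ at the morphisms whose kernel and cokernel lie in $\mathrm{Coh}(\mathcal{X})_0$. Write $\mathrm{Coh}(\mathcal{X})\to\mathrm{Coh}(\mathcal{X}_K)$, $E\mapsto E_K$, $f\mapsto f_K$ for the projection and $\mathrm{Hom}_K$ for the morphisms in $\mathrm{Coh}(\mathcal{X}_K)$. Then $\mathrm{Coh}(\mathcal{X}_K)$ is an abelian category and it carries a $K$-linear structure such that the projection $\mathrm{Coh}(\mathcal{X})\to\mathrm{Coh}(\mathcal{X}_K)$ is $R$-linear and such that, for all $F,G\in\mathrm{Coh}(\mathcal{X})$, the map induced by the projection, $f\otimes a\mapsto a\cdot f_K$, is a $K$-linear isomorphism $$\mathrm{Hom}(F,G)\otimes_R K\;\cong\;\mathrm{Hom}_K(F_K,G_K).$$ -/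

import Mathlib

open CategoryTheory Limits TopologicalSpace Opposite AlgebraicGeometry
open scoped TensorProduct

namespace FormalGenericFibre
universe u
noncomputable section

/-! ### Coherent sheaves of modules on a ringed space -/

section Ringed

variable {T : TopCat.{u}} {R : Sheaf (Opens.grothendieckTopology T) RingCat.{u}}

/-- The sections `M(U)`. -/
abbrev Sec (M : SheafOfModules.{u} R) (U : Opens T) : Type u := M.val.obj (op U)

/-- The ring of sections `R(U)` of the sheaf of rings `R`. -/
abbrev Fn (R : Sheaf (Opens.grothendieckTopology T) RingCat.{u}) (U : Opens T) : Type u :=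
  R.obj.obj (op U)

/-- Restriction of functions. -/
def Fn.res {U V : Opens T} (h : V ≤ U) : Fn R U →+* Fn R V := (R.obj.map (homOfLE h).op).hom

/-- Restriction of sections. -/
def Sec.res (M : SheafOfModules.{u} R) {U V : Opens T} (h : V ≤ U) :
    Sec M U →ₛₗ[Fn.res (R := R) h] Sec M V :=
  M.val.restrictₛₗ (homOfLE h).op

theorem Sec.res_res (M : SheafOfModules.{u} R) {U V W : Opens T} (h : V ≤ U) (k : W ≤ V)
    (s : Sec M U) : Sec.res M k (Sec.res M h s) = Sec.res M (k.trans h) s :=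
  (M.val.map_comp_apply (homOfLE h).op (homOfLE k).op s).symm

theorem Fn.res_res {U V W : Opens T} (h : V ≤ U) (k : W ≤ V) (s : Fn R U) :
    Fn.res (R := R) k (Fn.res h s) = Fn.res (R := R) (k.trans h) s := by
  have := R.obj.map_comp (homOfLE h).op (homOfLE k).op
  exact (ConcreteCategory.congr_hom this s).symm

theorem Sec.res_self (M : SheafOfModules.{u} R) {U : Opens T} (h : U ≤ U) (s : Sec M U) :
    Sec.res M h s = s := by
  have := M.val.presheaf.map_id (op U)
  exact (ConcreteCategory.congr_hom this s)

/-- The map `M(U) → N(U)` induced by a morphism of sheaves of modules. -/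
def Sec.map {M N : SheafOfModules.{u} R} (f : M ⟶ N) (U : Opens T) : Sec M U →ₗ[Fn R U] Sec N U :=
  (f.val.app (op U)).hom

theorem Sec.map_res {M N : SheafOfModules.{u} R} (f : M ⟶ N) {U V : Opens T} (h : V ≤ U)
    (s : Sec M U) : Sec.map f V (Sec.res M h s) = Sec.res N h (Sec.map f U s) :=
  PresheafOfModules.naturality_apply f.val (homOfLE h).op s

theorem Sec.map_injective {M N : SheafOfModules.{u} R} (f : M ⟶ N) [Mono f] (U : Opens T) :
    Function.Injective (Sec.map f U) := by
  have : Mono ((SheafOfModules.evaluation R (op U)).map f) := inferInstance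
  exact (ModuleCat.mono_iff_injective _).1 this

instance (X : (Opens T)ᵒᵖ) : (SheafOfModules.evaluation R X).PreservesZeroMorphisms :=
  ⟨fun _ _ ↦ rfl⟩

theorem Sec.exact_of_isLimit {M N P : SheafOfModules.{u} R} (f : M ⟶ N) (g : N ⟶ P) (w : f ≫ g = 0)
    (hk : IsLimit (KernelFork.ofι f w)) (U : Opens T) (n : Sec N U) (hn : Sec.map g U n = 0) :
    ∃ m, Sec.map f U m = n := by
  have h := ((ShortComplex.mk f g w).exact_of_f_is_kernel hk)
  have : Mono (ShortComplex.mk f g w).f := mono_of_isLimit_fork hk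
  have h2 := h.map_of_mono_of_preservesKernel (SheafOfModules.evaluation R (op U))
    this inferInstance
  rw [ShortComplex.moduleCat_exact_iff] at h2
  exact h2 n hn

theorem exists_locallyInjective (Q : PresheafOfModules.{u} R.obj) :
    ∃ (N : SheafOfModules.{u} R) (u : Q ⟶ N.val),
      Presheaf.IsLocallyInjective (Opens.grothendieckTopology T)
        ((PresheafOfModules.toPresheaf R.obj).map u) := by
  let adj := PresheafOfModules.sheafificationAdjunction (𝟙 R.obj)
  refine ⟨(PresheafOfModules.sheafification (𝟙 R.obj)).obj Q, adj.unit.app Q, ?_⟩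
  exact inferInstanceAs (Presheaf.IsLocallyInjective (Opens.grothendieckTopology T)
    (CategoryTheory.toSheafify (Opens.grothendieckTopology T) Q.presheaf))

theorem Sec.locally_surjective {M N : SheafOfModules.{u} R} (f : M ⟶ N) [Epi f] (U : Opens T)
    (n : Sec N U) (x : T) (hx : x ∈ U) :
    ∃ (V : Opens T) (h : V ≤ U) (_ : x ∈ V) (m : Sec M V), Sec.map f V m = Sec.res N h n := by
  obtain ⟨N', u, hu⟩ := exists_locallyInjective (cokernel f.val)
  let p : N.val ⟶ cokernel f.val := cokernel.π f.val
  have hp : f.val ≫ p = 0 := cokernel.condition _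
  let q : N ⟶ N' := ⟨p ≫ u⟩
  have hq : q = 0 := by
    rw [← cancel_epi f, comp_zero]
    ext1
    change f.val ≫ p ≫ u = 0
    rw [← Category.assoc, hp, zero_comp]
  have hq' : p ≫ u = 0 := congrArg SheafOfModules.Hom.val hq
  have h0 : u.app (op U) (p.app (op U) n) = 0 := by
    change (p ≫ u).app (op U) n = 0
    rw [hq']; rfl
  have hs := hu.equalizerSieve_mem (X := op U) (p.app (op U) n) 0
    (h0.trans (map_zero (u.app (op U)).hom).symm)
  obtain ⟨V, i, hV, hxV⟩ := hs x hx
  refine ⟨V, leOfHom i, hxV, ?_⟩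
  have h1 : p.app (op V) (Sec.res N (leOfHom i) n) = 0 := by
    refine (PresheafOfModules.naturality_apply p i.op n).trans ?_
    exact hV.trans (map_zero ((cokernel f.val).restrictₛₗ i.op))
  have hex : (ShortComplex.mk f.val p hp).Exact := ShortComplex.exact_cokernel _
  have hex2 := hex.map (PresheafOfModules.evaluation R.obj (op V))
  rw [ShortComplex.moduleCat_exact_iff] at hex2
  exact hex2 _ h1

theorem Sec.locally_exact {M N P : SheafOfModules.{u} R} (f : M ⟶ N) (g : N ⟶ P) (w : f ≫ g = 0)
    (hk : IsColimit (CokernelCofork.ofπ g w)) (U : Opens T) (n : Sec N U)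
    (hn : Sec.map g U n = 0) (x : T) (hx : x ∈ U) :
    ∃ (V : Opens T) (h : V ≤ U) (_ : x ∈ V) (m : Sec M V), Sec.map f V m = Sec.res N h n := by
  have h := ((ShortComplex.mk f g w).exact_of_g_is_cokernel hk)
  rw [ShortComplex.exact_iff_epi_kernel_lift] at h
  dsimp only at h
  obtain ⟨k, hk⟩ := Sec.exact_of_isLimit (kernel.ι g) g (kernel.condition g) (kernelIsKernel g)
    U n hn
  obtain ⟨V, hV, hxV, m, hm⟩ := Sec.locally_surjective (kernel.lift g f w) U k x hx
  refine ⟨V, hV, hxV, m, ?_⟩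
  have e : f = kernel.lift g f w ≫ kernel.ι g := (kernel.lift_ι g f w).symm
  rw [← hk, ← Sec.map_res, ← hm]
  exact congrArg (fun φ ↦ Sec.map φ V m) e

/-- The sections `s i` of `M` on `U` generate the restriction of `M` to `U`: every section is
locally a linear combination of them. -/
def Generates (M : SheafOfModules.{u} R) {U : Opens T} {ι : Type} [Fintype ι]
    (s : ι → Sec M U) : Prop :=
  ∀ (V : Opens T) (h : V ≤ U) (m : Sec M V) (x : T), x ∈ V →
    ∃ (W : Opens T) (k : W ≤ V) (_ : x ∈ W) (a : ι → Fn R W),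
      Sec.res M k m = ∑ i, a i • Sec.res M (k.trans h) (s i)

/-- `M` is of finite type: locally it is generated by finitely many sections. -/
def IsFiniteType (M : SheafOfModules.{u} R) : Prop :=
  ∀ x : T, ∃ (U : Opens T) (_ : x ∈ U) (ι : Type) (_ : Fintype ι) (s : ι → Sec M U),
    Generates M s

/-- The sheaf of relations between the sections `s i` of `M` on `U` is of finite type. -/
def RelationsFiniteType (M : SheafOfModules.{u} R) {U : Opens T} {ι : Type} [Fintype ι]
    (s : ι → Sec M U) : Prop :=
  ∀ x : T, x ∈ U → ∃ (V : Opens T) (h : V ≤ U) (_ : x ∈ V) (κ : Type) (_ : Fintype κ)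
    (r : κ → ι → Fn R V),
    (∀ j, ∑ i, r j i • Sec.res M h (s i) = 0) ∧
    ∀ (W : Opens T) (k : W ≤ V) (a : ι → Fn R W),
      ∑ i, a i • Sec.res M (k.trans h) (s i) = 0 →
      ∀ y : T, y ∈ W → ∃ (W' : Opens T) (l : W' ≤ W) (_ : y ∈ W') (c : κ → Fn R W'),
        ∀ i, Fn.res (R := R) l (a i) = ∑ j, c j * Fn.res (R := R) (l.trans k) (r j i)

variable (R) in
/-- Coherent sheaves of modules, in the usual sense of Serre: `M` is of finite type and, for every
open `U` and all sections `s_1, …, s_n` of `M` on `U`, the kernel of `(s_i) : R^n|_U ⟶ M|_U` is of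
finite type. -/
def isCoherent : ObjectProperty (SheafOfModules.{u} R) := fun M ↦
  IsFiniteType M ∧
    ∀ (U : Opens T) (ι : Type) [Fintype ι] (s : ι → Sec M U), RelationsFiniteType M s

theorem coherent_of_kernel {A B C : SheafOfModules.{u} R} (f : A ⟶ B) (g : B ⟶ C)
    (hinj : ∀ U, Function.Injective (Sec.map f U))
    (hex : ∀ U n, Sec.map g U n = 0 → ∃ m, Sec.map f U m = n)
    (hz : ∀ U m, Sec.map g U (Sec.map f U m) = 0)
    (hB : isCoherent R B) (hC : isCoherent R C) : isCoherent R A := by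
  refine ⟨fun x ↦ ?_, fun U ι _ s x hx ↦ ?_⟩
  · obtain ⟨U, hxU, ι, _, s, hs⟩ := hB.1 x
    obtain ⟨V, h, hxV, κ, _, r, hr, hr'⟩ := hC.2 U ι (fun i ↦ Sec.map g U (s i)) x hxU
    have (j : κ) : ∃ m, Sec.map f V m = ∑ i, r j i • Sec.res B h (s i) :=
      hex V _ (by simpa [Sec.map_res] using hr j)
    choose t ht using this
    refine ⟨V, hxV, κ, inferInstance, t, fun W k m y hy ↦ ?_⟩
    obtain ⟨W₁, k₁, hy₁, a, ha⟩ := hs W (k.trans h) (Sec.map f W m) y hy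
    have ha0 : ∑ i, a i • Sec.res C ((k₁.trans k).trans h) (Sec.map g U (s i)) = 0 := by
      have := congrArg (Sec.map g W₁) ha
      rw [Sec.map_res, hz, map_zero] at this
      simpa [Sec.map_res] using this.symm
    obtain ⟨W₂, k₂, hy₂, c, hc⟩ := hr' W₁ (k₁.trans k) a ha0 y hy₁
    refine ⟨W₂, k₂.trans k₁, hy₂, c, hinj W₂ ?_⟩
    rw [Sec.map_res, ← Sec.res_res B k₁ k₂, ha]
    simp only [map_sum, map_smulₛₗ, Sec.res_res, Sec.map_res, ht, hc, Finset.sum_smul,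
      Finset.smul_sum, mul_smul, RingHom.id_apply]
    exact Finset.sum_comm
  · obtain ⟨V, h, hxV, κ, _, r, hr, hr'⟩ := hB.2 U ι (fun i ↦ Sec.map f U (s i)) x hx
    refine ⟨V, h, hxV, κ, inferInstance, r, fun j ↦ hinj V ?_, fun W k a ha ↦ hr' W k a ?_⟩
    · simpa [Sec.map_res] using hr j
    · simpa [Sec.map_res] using congrArg (Sec.map f W) ha

theorem exists_common_nhds {ι : Type} [Fintype ι] {U : Opens T} {x : T} (hx : x ∈ U)
    (V : ι → Opens T) (hV : ∀ i, x ∈ V i) :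
    ∃ W : Opens T, W ≤ U ∧ x ∈ W ∧ ∀ i, W ≤ V i := by
  refine ⟨U ⊓ Finset.univ.inf V, inf_le_left, ⟨hx, ?_⟩,
    fun i ↦ inf_le_right.trans (Finset.inf_le (Finset.mem_univ i))⟩
  simpa using hV

theorem coherent_of_cokernel {A B C : SheafOfModules.{u} R} (f : A ⟶ B) (g : B ⟶ C)
    (hsurj : ∀ U (n : Sec C U) x, x ∈ U →
      ∃ (V : Opens T) (h : V ≤ U) (_ : x ∈ V) (m : Sec B V), Sec.map g V m = Sec.res C h n)
    (hex : ∀ U (n : Sec B U), Sec.map g U n = 0 → ∀ x, x ∈ U →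
      ∃ (V : Opens T) (h : V ≤ U) (_ : x ∈ V) (m : Sec A V), Sec.map f V m = Sec.res B h n)
    (hz : ∀ U m, Sec.map g U (Sec.map f U m) = 0)
    (hA : IsFiniteType A) (hB : isCoherent R B) : isCoherent R C := by
  refine ⟨fun x ↦ ?_, fun U ι _ s x hx ↦ ?_⟩
  · obtain ⟨U, hxU, ι, _, s, hs⟩ := hB.1 x
    refine ⟨U, hxU, ι, inferInstance, fun i ↦ Sec.map g U (s i), fun W k m y hy ↦ ?_⟩
    obtain ⟨W₁, k₁, hy₁, b, hb⟩ := hsurj W m y hy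
    obtain ⟨W₂, k₂, hy₂, a, ha⟩ := hs W₁ (k₁.trans k) b y hy₁
    refine ⟨W₂, k₂.trans k₁, hy₂, a, ?_⟩
    rw [← Sec.res_res C k₁ k₂, ← hb, ← Sec.map_res, ha]
    simp [Sec.map_res]
  · choose V₀ h₀ hx₀ b₀ hb₀ using fun i ↦ hsurj U (s i) x hx
    obtain ⟨V₁, hx₁, κ, _, t, ht⟩ := hA x
    obtain ⟨V, hV, hxV, hV₀⟩ := exists_common_nhds (U := U ⊓ V₁) ⟨hx, hx₁⟩ V₀ hx₀
    have hVU : V ≤ U := hV.trans inf_le_left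
    have hV₁ : V ≤ V₁ := hV.trans inf_le_right
    let b (i : ι) : Sec B V := Sec.res B (hV₀ i) (b₀ i)
    have hb (i : ι) : Sec.map g V (b i) = Sec.res C hVU (s i) := by
      simp only [b, Sec.map_res, hb₀, Sec.res_res]
    let e (k : κ) : Sec B V := Sec.map f V (Sec.res A hV₁ (t k))
    have he (k : κ) : Sec.map g V (e k) = 0 := hz _ _
    obtain ⟨W, k, hxW, μ, _, r, hr, hr'⟩ := hB.2 V (ι ⊕ κ) (Sum.elim b e) x hxV
    refine ⟨W, k.trans hVU, hxW, μ, inferInstance, fun j i ↦ r j (Sum.inl i),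
      fun j ↦ ?_, fun W₁ k₁ a ha y hy ↦ ?_⟩
    · have := congrArg (Sec.map g W) (hr j)
      simpa [Sec.map_res, hb, he, Sec.res_res] using this
    · obtain ⟨W₂, k₂, hy₂, α, hα⟩ := hex W₁ (∑ i, a i • Sec.res B (k₁.trans k) (b i))
        (by simpa [Sec.map_res, hb, Sec.res_res] using ha) y hy
      obtain ⟨W₃, k₃, hy₃, c, hc⟩ := ht W₂ (k₂.trans (k₁.trans (k.trans hV₁))) α y hy₂
      have hrel := congrArg (Sec.map f W₃) hc
      rw [Sec.map_res, hα] at hrel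
      obtain ⟨W₄, k₄, hy₄, d, hd⟩ := hr' W₃ (k₃.trans (k₂.trans k₁))
        (Sum.elim (fun i ↦ Fn.res (R := R) (k₃.trans k₂) (a i)) (fun j ↦ - c j))
        (by
          simp only [map_sum, map_smulₛₗ, Sec.res_res, Sec.map_res, RingHom.id_apply,
            Fn.res_res] at hrel
          simp [Fintype.sum_sum_type, e, Sec.map_res, Sec.res_res, hrel]) y hy₃
      refine ⟨W₄, k₄.trans (k₃.trans k₂), hy₄, d, fun i ↦ ?_⟩
      simpa [Fn.res_res] using hd (Sum.inl i)

theorem coherent_of_biproduct {A B C : SheafOfModules.{u} R} (p : B ⟶ A) (q : B ⟶ C)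
    (i : A ⟶ B) (j : C ⟶ B)
    (h1 : ∀ U m, m = Sec.map i U (Sec.map p U m) + Sec.map j U (Sec.map q U m))
    (hA : isCoherent R A) (hC : isCoherent R C) : isCoherent R B := by
  refine ⟨fun x ↦ ?_, fun U ι _ s x hx ↦ ?_⟩
  · obtain ⟨U₁, hx₁, ι₁, _, s, hs⟩ := hA.1 x
    obtain ⟨U₂, hx₂, ι₂, _, t, ht⟩ := hC.1 x
    refine ⟨U₁ ⊓ U₂, ⟨hx₁, hx₂⟩, ι₁ ⊕ ι₂, inferInstance,
      Sum.elim (fun k ↦ Sec.map i _ (Sec.res A inf_le_left (s k)))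
        (fun k ↦ Sec.map j _ (Sec.res C inf_le_right (t k))), fun W k m y hy ↦ ?_⟩
    obtain ⟨W₁, k₁, hy₁, a, ha⟩ := hs W (k.trans inf_le_left) (Sec.map p W m) y hy
    obtain ⟨W₂, k₂, hy₂, c, hc⟩ := ht W₁ (k₁.trans (k.trans inf_le_right))
      (Sec.map q W₁ (Sec.res B k₁ m)) y hy₁
    refine ⟨W₂, k₂.trans k₁, hy₂, Sum.elim (fun l ↦ Fn.res (R := R) k₂ (a l)) c, ?_⟩
    have ha' := congrArg (Sec.res A k₂) ha
    simp only [Sec.res_res, map_sum, map_smulₛₗ, Sec.map_res] at ha' hc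
    rw [h1 W₂ (Sec.res B _ m)]
    simp [Fintype.sum_sum_type, Sec.map_res, Sec.res_res, ha', hc]
  · obtain ⟨V, h, hxV, κ, _, r, hr, hr'⟩ := hA.2 U ι (fun i ↦ Sec.map p U (s i)) x hx
    obtain ⟨V', h', hxV', μ, _, r', hs, hs'⟩ := hC.2 V κ
      (fun k ↦ ∑ l, r k l • Sec.res C h (Sec.map q U (s l))) x hxV
    refine ⟨V', h'.trans h, hxV', μ, inferInstance,
      fun m l ↦ ∑ k, r' m k * Fn.res (R := R) h' (r k l), fun m ↦ ?_, fun W k a ha y hy ↦ ?_⟩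
    · rw [h1 V' (∑ l, _)]
      have e1 : Sec.map p V' (∑ l, (∑ k, r' m k * Fn.res (R := R) h' (r k l)) •
          Sec.res B (h'.trans h) (s l)) = 0 := by
        have : ∑ k, r' m k • Sec.res A h' (∑ l, r k l • Sec.res A h (Sec.map p U (s l))) = 0 := by
          simp [hr]
        rw [← this]
        simp only [map_sum, map_smulₛₗ, Sec.res_res, Sec.map_res, Finset.sum_smul,
          Finset.smul_sum, mul_smul, RingHom.id_apply]
        exact Finset.sum_comm
      have e2 : Sec.map q V' (∑ l, (∑ k, r' m k * Fn.res (R := R) h' (r k l)) •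
          Sec.res B (h'.trans h) (s l)) = 0 := by
        rw [← hs m]
        simp only [map_sum, map_smulₛₗ, Sec.res_res, Sec.map_res, Finset.sum_smul,
          Finset.smul_sum, mul_smul, RingHom.id_apply]
        exact Finset.sum_comm
      rw [e1, e2, map_zero, map_zero, add_zero]
    · have hp := congrArg (Sec.map p W) ha
      have hq := congrArg (Sec.map q W) ha
      simp only [map_sum, map_smulₛₗ, Sec.map_res, RingHom.id_apply, map_zero] at hp hq
      obtain ⟨W₁, k₁, hy₁, c, hc⟩ := hr' W (k.trans h') a hp y hy
      obtain ⟨W₂, k₂, hy₂, d, hd⟩ := hs' W₁ (k₁.trans k) c (by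
        have hq' := congrArg (Sec.res C k₁) hq
        simp only [map_sum, map_smulₛₗ, Sec.res_res, map_zero, hc, Finset.sum_smul,
          mul_smul] at hq'
        rw [Finset.sum_comm] at hq'
        simpa [Sec.res_res, Finset.smul_sum] using hq') y hy₁
      refine ⟨W₂, k₂.trans k₁, hy₂, d, fun l ↦ ?_⟩
      have := congrArg (Fn.res (R := R) k₂) (hc l)
      simp only [Fn.res_res, map_sum, map_mul, hd, Finset.sum_mul] at this
      rw [this, Finset.sum_comm]
      simp only [Fn.res_res, map_sum, map_mul, Finset.mul_sum, mul_assoc]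

instance : (isCoherent R).IsClosedUnderKernels where
  kernels_le := by
    rintro _ ⟨f, k, hk, hB, hC⟩
    have : Mono k.ι := mono_of_isLimit_fork hk
    refine coherent_of_kernel k.ι f (Sec.map_injective k.ι)
      (Sec.exact_of_isLimit k.ι f k.condition
        (IsLimit.ofIsoLimit hk (Fork.ext (Iso.refl _) (by simp)))) (fun U m ↦ ?_) hB hC
    exact congrArg (fun φ ↦ Sec.map φ U m) k.condition

instance : (isCoherent R).IsClosedUnderCokernels where
  cokernels_le := by
    rintro _ ⟨f, k, hk, hA, hB⟩
    have : Epi k.π := epi_of_isColimit_cofork hk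
    refine coherent_of_cokernel f k.π (Sec.locally_surjective k.π)
      (Sec.locally_exact f k.π k.condition
        (IsColimit.ofIsoColimit hk (Cofork.ext (Iso.refl _) (by simp)))) (fun U m ↦ ?_) hA.1 hB
    exact congrArg (fun φ ↦ Sec.map φ U m) k.condition

theorem coherent_of_isZero {Z : SheafOfModules.{u} R} (hZ : IsZero Z) : isCoherent R Z := by
  have h0 (U : Opens T) (m : Sec Z U) : m = 0 :=
    congrArg (fun φ ↦ Sec.map φ U m) (hZ.eq_of_src (𝟙 Z) 0)
  refine ⟨fun x ↦ ⟨⊤, trivial, Fin 0, inferInstance, 0, fun V h m y hy ↦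
    ⟨V, le_rfl, hy, 0, (h0 _ _).trans (h0 _ _).symm⟩⟩, fun U ι _ s x hx ↦ ?_⟩
  classical
  exact ⟨U, le_rfl, hx, ι, inferInstance, fun i j ↦ if i = j then 1 else 0,
    fun _ ↦ h0 _ _, fun W k a _ y hy ↦ ⟨W, le_rfl, hy, a, fun i ↦ by
      have : Fn.res (R := R) (le_refl W) (a i) = a i :=
        ConcreteCategory.congr_hom (R.obj.map_id (op W)) (a i)
      simp [this, apply_ite]⟩⟩

instance : (isCoherent R).ContainsZero where
  exists_zero := ⟨_, isZero_zero _, coherent_of_isZero (isZero_zero _)⟩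

instance : (isCoherent R).IsClosedUnderIsomorphisms where
  of_iso e h := by
    refine coherent_of_kernel e.inv 0 (Sec.map_injective e.inv) (fun U n _ ↦ ⟨Sec.map e.hom U n, ?_⟩) (fun U m ↦ rfl) h h
    exact congrArg (fun φ ↦ Sec.map φ U n) e.hom_inv_id

instance : (isCoherent R).IsClosedUnderBinaryProducts where
  limitsOfShape_le := by
    rintro B ⟨P⟩
    let c : BinaryFan (P.diag.obj ⟨.left⟩) (P.diag.obj ⟨.right⟩) :=
      (Cone.postcompose (diagramIsoPair P.diag).hom).obj (Cone.mk B P.π)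
    have hc : IsLimit c := (IsLimit.postcomposeHomEquiv _ _).symm P.isLimit
    obtain ⟨i, hi₁, hi₂⟩ := BinaryFan.IsLimit.lift' hc (𝟙 _) 0
    obtain ⟨j, hj₁, hj₂⟩ := BinaryFan.IsLimit.lift' hc 0 (𝟙 _)
    let p : B ⟶ P.diag.obj ⟨.left⟩ := c.fst
    let q : B ⟶ P.diag.obj ⟨.right⟩ := c.snd
    change _ ⟶ B at i j
    change i ≫ p = 𝟙 _ at hi₁
    change i ≫ q = 0 at hi₂
    change j ≫ p = 0 at hj₁
    change j ≫ q = 𝟙 _ at hj₂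
    have h1 : 𝟙 B = p ≫ i + q ≫ j := by
      refine BinaryFan.IsLimit.hom_ext hc ?_ ?_
      · change 𝟙 B ≫ p = (p ≫ i + q ≫ j) ≫ p
        simp [hi₁, hj₁]
      · change 𝟙 B ≫ q = (p ≫ i + q ≫ j) ≫ q
        simp [hi₂, hj₂]
    exact coherent_of_biproduct p q i j
      (fun U m ↦ congrArg (fun φ ↦ Sec.map φ U m) h1) (P.prop_diag_obj _) (P.prop_diag_obj _)

instance : (isCoherent R).IsClosedUnderFiniteProducts := .mk'

end Ringed

/-! ### The action of global functions -/

section GlobalFunctions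

variable (Y : LocallyRingedSpace.{u})

/-- The structure sheaf of a locally ringed space, as a sheaf of rings. -/
abbrev ringSheaf : Sheaf (Opens.grothendieckTopology Y.toTopCat) RingCat.{u} :=
  (sheafCompose _ (forget₂ CommRingCat RingCat.{u})).obj Y.sheaf

variable {Y}

/-- The restriction `Γ(Y, 𝒪_Y) → Γ(U, 𝒪_Y)`. -/
def restrictGlobal (U : Opens Y.toTopCat) :
    LocallyRingedSpace.Γ.obj (op Y) →+* Fn (ringSheaf Y) U :=
  (Y.presheaf.map (homOfLE (le_top : U ≤ ⊤)).op).hom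

theorem Fn.mul_comm {U : Opens Y.toTopCat} (a b : Fn (ringSheaf Y) U) : a * b = b * a :=
  _root_.mul_comm (G := Y.presheaf.obj (op U)) a b

theorem res_restrictGlobal {U V : Opens Y.toTopCat} (h : V ≤ U)
    (a : LocallyRingedSpace.Γ.obj (op Y)) :
    Fn.res (R := ringSheaf Y) h (restrictGlobal U a) = restrictGlobal V a :=
  Fn.res_res (R := ringSheaf Y) le_top h a

/-- Multiplication by a global function `a` on a sheaf of modules: on sections over `U` it is
multiplication by `a|_U`. -/
def globalMul (a : LocallyRingedSpace.Γ.obj (op Y)) (M : SheafOfModules.{u} (ringSheaf Y)) :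
    M ⟶ M where
  val :=
    { app := fun U ↦ ModuleCat.ofHom
        { toFun := fun m ↦ (show Sec M U.unop from restrictGlobal U.unop a • (m : Sec M U.unop))
          map_add' := fun _ _ ↦ smul_add _ _ _
          map_smul' := fun r m ↦ by
            change restrictGlobal U.unop a • (show Fn (ringSheaf Y) U.unop from r) •
              (m : Sec M U.unop) = (show Fn (ringSheaf Y) U.unop from r) • _
            rw [smul_smul, smul_smul, Fn.mul_comm] }
      naturality := fun {U V} f ↦ by
        ext m
        have h := Sec.res M (leOfHom f.unop) |>.map_smulₛₗ (restrictGlobal U.unop a) m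
        rw [res_restrictGlobal] at h
        exact h.symm }

theorem map_globalMul (a : LocallyRingedSpace.Γ.obj (op Y)) (M : SheafOfModules.{u} (ringSheaf Y))
    (U : Opens Y.toTopCat) (m : Sec M U) :
    Sec.map (globalMul a M) U m = restrictGlobal U a • m := rfl

theorem Sec.hom_ext {M N : SheafOfModules.{u} (ringSheaf Y)} {f g : M ⟶ N}
    (h : ∀ U (m : Sec M U), Sec.map f U m = Sec.map g U m) : f = g := by
  ext U m
  exact h U.unop m

variable (Y) in
/-- The ring homomorphism from global functions to the centre of the category of sheaves of
modules. -/
def globalCenter :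
    LocallyRingedSpace.Γ.obj (op Y) →+* CatCenter (SheafOfModules.{u} (ringSheaf Y)) where
  toFun a :=
    { app := globalMul a
      naturality := fun M N f ↦ Sec.hom_ext fun U m ↦
        ((Sec.map f U).map_smul (restrictGlobal U a) m).symm }
  map_one' := by
    refine NatTrans.ext (funext fun M ↦ Sec.hom_ext fun U m ↦ ?_)
    change restrictGlobal U 1 • m = m
    rw [map_one, one_smul]
  map_mul' a b := by
    refine NatTrans.ext (funext fun M ↦ Sec.hom_ext fun U m ↦ ?_)
    change restrictGlobal U (a * b) • m = restrictGlobal U a • restrictGlobal U b • m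
    rw [map_mul, mul_smul]
  map_zero' := by
    refine NatTrans.ext (funext fun M ↦ Sec.hom_ext fun U m ↦ ?_)
    change restrictGlobal U 0 • m = 0
    rw [map_zero, zero_smul]
  map_add' a b := by
    refine NatTrans.ext (funext fun M ↦ Sec.hom_ext fun U m ↦ ?_)
    change restrictGlobal U (a + b) • m = restrictGlobal U a • m + restrictGlobal U b • m
    rw [map_add, add_smul]

/-- A ring homomorphism `A → Γ(Y, 𝒪_Y)` makes the category of `𝒪_Y`-modules `A`-linear: `a • f` is
`f` followed by the multiplication by the image of `a`. -/
@[reducible]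
def linearOfGlobal {A : Type u} [CommRing A] (φ : A →+* LocallyRingedSpace.Γ.obj (op Y)) :
    Linear A (SheafOfModules.{u} (ringSheaf Y)) :=
  Linear.ofRingMorphism ((globalCenter Y).comp φ)

end GlobalFunctions

section Torsion

variable {C : Type*} [Category C] [Abelian C] {A : Type*} [CommRing A] [Linear A C]

/-- The objects of an `A`-linear category that are annihilated by a power of `t`. -/
def powerTorsion (C : Type*) [Category C] [Preadditive C] {A : Type*} [CommRing A] [Linear A C]
    (t : A) : ObjectProperty C :=
  fun E ↦ ∃ n : ℕ, t ^ (n + 1) • 𝟙 E = 0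

instance (t : A) : (powerTorsion C t).IsSerreClass where
  exists_zero := ⟨_, isZero_zero C, 0, (isZero_zero C).eq_of_src _ _⟩
  prop_of_mono := by
    rintro X Y f _ ⟨n, hn⟩
    refine ⟨n, ?_⟩
    rw [← cancel_mono f, zero_comp, Linear.smul_comp, Category.id_comp, ← Category.comp_id f,
      ← Linear.comp_smul, hn, comp_zero]
  prop_of_epi := by
    rintro X Y f _ ⟨n, hn⟩
    refine ⟨n, ?_⟩
    rw [← cancel_epi f, comp_zero, Linear.comp_smul, Category.comp_id, ← Category.id_comp f,
      ← Linear.smul_comp, hn, zero_comp]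
  prop_X₂_of_shortExact := by
    rintro S hS ⟨a, ha⟩ ⟨b, hb⟩
    have := hS.mono_f
    refine ⟨a + (b + 1), ?_⟩
    obtain ⟨l, hl⟩ : ∃ l : S.X₂ ⟶ S.X₁, l ≫ S.f = t ^ (b + 1) • 𝟙 S.X₂ := by
      refine ⟨hS.exact.lift (t ^ (b + 1) • 𝟙 S.X₂) ?_, hS.exact.lift_f _ _⟩
      rw [Linear.smul_comp, Category.id_comp, ← Category.comp_id S.g, ← Linear.comp_smul, hb,
        comp_zero]
    rw [show a + (b + 1) + 1 = (a + 1) + (b + 1) by ring, pow_add, mul_smul, ← hl,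
      ← Linear.smul_comp, ← Category.comp_id l, ← Linear.comp_smul, ha, comp_zero, zero_comp]

end Torsion

/-! ### Formal deformations of smooth projective varieties -/

/-- The discrete valuation ring `R = ℂ[[t]]`. -/
abbrev BaseRing : Type := PowerSeries ℂ

/-- The field of fractions `K = ℂ((t))` of `R`. -/
abbrev BaseField : Type := LaurentSeries ℂ

/-- The parameter `t`. -/
abbrev param : BaseRing := PowerSeries.X

/-- `R_n = R / (t ^ (n + 1)) = ℂ[t] / (t ^ (n + 1))`. -/
abbrev TruncRing (n : ℕ) : Type := BaseRing ⧸ Ideal.span {param ^ (n + 1)}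

/-- The closed immersion `Spec R_n ⟶ Spec R_{n+1}`. -/
def specTrunc (n : ℕ) :
    Spec (CommRingCat.of (TruncRing n)) ⟶ Spec (CommRingCat.of (TruncRing (n + 1))) :=
  Spec.map (CommRingCat.ofHom (Ideal.Quotient.factor
    (Ideal.span_singleton_le_span_singleton.2 (pow_dvd_pow param (Nat.le_succ (n + 1))))))

/-- The closed immersion `Spec R_n ⟶ Spec R`. -/
def specTruncToBase (n : ℕ) :
    Spec (CommRingCat.of (TruncRing n)) ⟶ Spec (CommRingCat.of BaseRing) :=
  Spec.map (CommRingCat.ofHom (Ideal.Quotient.mk _))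

theorem specTrunc_comp (n : ℕ) :
    specTrunc n ≫ specTruncToBase (n + 1) = specTruncToBase n := by
  rw [specTrunc, specTruncToBase, ← Spec.map_comp]
  rfl

attribute [local instance] MvPolynomial.gradedAlgebra

/-- Projective space of dimension `N` over `ℂ`. -/
def projectiveSpace (N : ℕ) : Scheme.{0} :=
  Proj (MvPolynomial.homogeneousSubmodule (Fin (N + 1)) ℂ)

/-- The structure morphism of projective space. -/
def projectiveSpaceStr (N : ℕ) : projectiveSpace N ⟶ Spec (CommRingCat.of ℂ) :=
  Proj.toSpecZero (MvPolynomial.homogeneousSubmodule (Fin (N + 1)) ℂ) ≫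
    Spec.map (CommRingCat.ofHom (algebraMap ℂ _))

/-- The `ℂ`-scheme `s : X ⟶ Spec ℂ` is a smooth projective variety: an integral closed subscheme
of some projective space, smooth over `ℂ`. -/
structure IsSmoothProjectiveVariety {X : Scheme.{0}} (s : X ⟶ Spec (CommRingCat.of ℂ)) : Prop where
  integral : IsIntegral X
  smooth : Smooth s
  projective : ∃ (N : ℕ) (i : X ⟶ projectiveSpace N),
    IsClosedImmersion i ∧ i ≫ projectiveSpaceStr N = s

/-- A formal deformation over `Spf ℂ[[t]]` of the `ℂ`-scheme `s : X ⟶ Spec ℂ`: an inductive system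
of flat `R_n`-schemes `𝒳_n` with `𝒳_n ≅ 𝒳_{n+1} ×_{R_{n+1}} R_n`, together with an isomorphism of
`ℂ`-schemes `𝒳_0 ≅ X`. -/
structure FormalDeformation {X : Scheme.{0}} (s : X ⟶ Spec (CommRingCat.of ℂ)) where
  obj : ℕ → Scheme.{0}
  π (n : ℕ) : obj n ⟶ Spec (CommRingCat.of (TruncRing n))
  flat (n : ℕ) : Flat (π n)
  ι (n : ℕ) : obj n ⟶ obj (n + 1)
  isPullback (n : ℕ) : IsPullback (ι n) (π n) (π (n + 1)) (specTrunc n)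
  specialFibre : obj 0 ≅ X
  specialFibre_hom : specialFibre.hom ≫ s =
    π 0 ≫ Spec.map (CommRingCat.ofHom (algebraMap ℂ (TruncRing 0)))

namespace FormalDeformation

variable {X : Scheme.{0}} {s : X ⟶ Spec (CommRingCat.of ℂ)} (𝒳 : FormalDeformation s)

/-- The inductive system `𝒳_0 ⟶ 𝒳_1 ⟶ ⋯`. -/
def system : ℕ ⥤ LocallyRingedSpace.{0} :=
  Functor.ofSequence 𝒳.ι ⋙ Scheme.forgetToLocallyRingedSpace

/-- The formal scheme `𝒳`, i.e. the colimit of the `𝒳_n` as a locally ringed space. Colimits of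
locally ringed spaces are formed on underlying ringed spaces and the transition maps `𝒳_n ⟶ 𝒳_{n+1}`
are homeomorphisms, so this is the topological space `X` with the sheaf of rings `lim 𝒪_{𝒳_n}`. -/
def space : LocallyRingedSpace.{0} := colimit 𝒳.system

/-- The structure morphism `𝒳 ⟶ Spec R`, which is `π_n` on `𝒳_n`. -/
def toBase : 𝒳.space ⟶ (Spec (CommRingCat.of BaseRing)).toLocallyRingedSpace :=
  colimit.desc 𝒳.system
    { pt := (Spec (CommRingCat.of BaseRing)).toLocallyRingedSpace
      ι := NatTrans.ofSequence
        (fun n ↦ Scheme.forgetToLocallyRingedSpace.map (𝒳.π n ≫ specTruncToBase n))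
        (fun n ↦ by
          have h : 𝒳.ι n ≫ 𝒳.π (n + 1) ≫ specTruncToBase (n + 1) =
              𝒳.π n ≫ specTruncToBase n := by
            rw [← Category.assoc, (𝒳.isPullback n).w, Category.assoc, specTrunc_comp]
          have e : 𝒳.system.map (homOfLE (Nat.le_add_right n 1)) =
              Scheme.forgetToLocallyRingedSpace.map (𝒳.ι n) :=
            congrArg (Scheme.forgetToLocallyRingedSpace.map ·)
              (Functor.ofSequence_map_homOfLE_succ 𝒳.ι n)
          rw [e]
          exact (congrArg Scheme.forgetToLocallyRingedSpace.map h).trans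
            (Category.comp_id _).symm) }

/-- The homomorphism `R → Γ(𝒳, 𝒪_𝒳)`. -/
def scalars : BaseRing →+* LocallyRingedSpace.Γ.obj (op 𝒳.space) :=
  ((Scheme.ΓSpecIso (CommRingCat.of BaseRing)).inv ≫ LocallyRingedSpace.Γ.map 𝒳.toBase.op).hom

/-- The category `Coh(𝒳)` of coherent sheaves of `𝒪_𝒳`-modules. -/
def Coh : Type 1 := (isCoherent (ringSheaf 𝒳.space)).FullSubcategory

instance : Category.{0} 𝒳.Coh :=
  inferInstanceAs (Category (isCoherent (ringSheaf 𝒳.space)).FullSubcategory)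

instance : Abelian 𝒳.Coh :=
  inferInstanceAs (Abelian (isCoherent (ringSheaf 𝒳.space)).FullSubcategory)

/-- The `R`-linear structure of `Coh(𝒳)`. -/
instance : Linear BaseRing 𝒳.Coh :=
  letI := linearOfGlobal 𝒳.scalars
  inferInstanceAs (Linear BaseRing (isCoherent (ringSheaf 𝒳.space)).FullSubcategory)

/-- The Serre subcategory `Coh(𝒳)_0` of `R`-torsion sheaves, i.e. of the coherent sheaves `E` such
that `t ^ (n + 1) E = 0` for some `n` (sheaves with support on some `𝒳_n`). -/
def torsion : ObjectProperty 𝒳.Coh := powerTorsion 𝒳.Coh param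

instance : 𝒳.torsion.IsSerreClass :=
  inferInstanceAs (powerTorsion 𝒳.Coh param).IsSerreClass

/-- The Serre quotient `Coh(𝒳_K) = Coh(𝒳) / Coh(𝒳)_0`: the localization of `Coh(𝒳)` with respect
to the morphisms whose kernel and cokernel belong to `Coh(𝒳)_0`. -/
def CohK : Type 1 := 𝒳.torsion.isoModSerre.Localization

instance : Category 𝒳.CohK := inferInstanceAs (Category 𝒳.torsion.isoModSerre.Localization)

/-- The projection `Coh(𝒳) ⥤ Coh(𝒳_K)`, `E ↦ E_K`. -/
def toCohK : 𝒳.Coh ⥤ 𝒳.CohK := 𝒳.torsion.isoModSerre.Q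

end FormalDeformation

end
end FormalGenericFibre

/-! The theorem is an instance of a fact about any `A`-linear abelian category `C` and any `t : A`:
dividing by the objects killed by a power of `t` has the same effect on Hom groups as inverting `t`.
For `A = ℂ[[t]]`, inverting `t` gives `K = ℂ((t))`.

The key point is `exists_comp_eq_pow_smul_id`: a morphism `s` with `t`-power torsion kernel and
cokernel has an inverse up to a power of `t`. A morphism of the quotient is a fraction whose
denominator is such an `s`, so some `t ^ n` times it comes from `C`. A morphism of `C` that dies in
the quotient has torsion image, so a power of `t` kills it (`exists_pow_smul_eq_zero_of_image`).
Together with the invertibility of `t` on Hom groups of the quotient, these are the axioms of a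
localized module, and localization is base change to `K`.

The `K`-linear structure comes from the centre: `A` acts on the identity functor of `C`, this action
passes to the quotient, and there `t` becomes a unit (`isUnit_serreQuotientCenter`), so the action
extends to `A[1/t]`. -/

namespace FormalGenericFibre

section SerreQuotient

variable {C : Type*} [Category* C] [Abelian C] {A : Type*} [CommRing A] [Linear A C] {t : A}

/-! ### Torsion and powers of `t` in the abelian category. -/

/-- A morphism whose kernel and cokernel are annihilated by powers of `t` is invertible up to a
power of `t`. -/
theorem exists_comp_eq_pow_smul_id {X Y : C} {s : X ⟶ Y}
    (hs : (powerTorsion C t).isoModSerre s) :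
    ∃ (g : Y ⟶ X) (n : ℕ), s ≫ g = t ^ n • 𝟙 X ∧ g ≫ s = t ^ n • 𝟙 Y := by
  obtain ⟨⟨a, ha⟩, ⟨b, hb⟩⟩ := hs
  have hs : Abelian.coimage.π s ≫ (Abelian.coimageIsoImage s).hom ≫ Abelian.image.ι s = s := by
    simp
  -- As `t ^ (b + 1)` kills the cokernel, multiplication by it on `Y` lands in the image of `s`.
  have hl₀ : (t ^ (b + 1) • 𝟙 Y) ≫ cokernel.π s = 0 := by
    rw [Linear.smul_comp, Category.id_comp, ← Category.comp_id (cokernel.π s),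
      ← Linear.comp_smul, hb, comp_zero]
  obtain ⟨l, hl⟩ : ∃ l : Y ⟶ Abelian.image s, l ≫ Abelian.image.ι s = t ^ (b + 1) • 𝟙 Y :=
    ⟨kernel.lift _ _ hl₀, kernel.lift_ι _ _ _⟩
  -- Dually, `t ^ (a + 1)` kills the kernel, so multiplication by it on `X` factors through the
  -- coimage.
  have hm₀ : kernel.ι s ≫ (t ^ (a + 1) • 𝟙 X) = 0 := by
    rw [Linear.comp_smul, Category.comp_id, ← Category.id_comp (kernel.ι s),
      ← Linear.smul_comp, ha, zero_comp]
  obtain ⟨m, hm⟩ : ∃ m : Abelian.coimage s ⟶ X, Abelian.coimage.π s ≫ m = t ^ (a + 1) • 𝟙 X :=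
    ⟨cokernel.desc _ _ hm₀, cokernel.π_desc _ _ _⟩
  have hsl : s ≫ l = t ^ (b + 1) • (Abelian.coimage.π s ≫ (Abelian.coimageIsoImage s).hom) := by
    rw [← cancel_mono (Abelian.image.ι s), Category.assoc, hl, Linear.smul_comp, Category.assoc,
      hs, Linear.comp_smul, Category.comp_id]
  have hms : m ≫ s = t ^ (a + 1) • ((Abelian.coimageIsoImage s).hom ≫ Abelian.image.ι s) := by
    rw [← cancel_epi (Abelian.coimage.π s), ← Category.assoc, hm, Linear.comp_smul, hs,
      Linear.smul_comp, Category.id_comp]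
  -- The quasi-inverse runs from `Y` to the image, across to the coimage, then to `X`; the two
  -- exponents add up.
  refine ⟨l ≫ (Abelian.coimageIsoImage s).inv ≫ m, (b + 1) + (a + 1), ?_, ?_⟩
  · rw [← Category.assoc, hsl, Linear.smul_comp, Category.assoc, Iso.hom_inv_id_assoc, hm,
      smul_smul, ← pow_add]
  · rw [Category.assoc, Category.assoc, hms, Linear.comp_smul, Iso.inv_hom_id_assoc,
      Linear.comp_smul, hl, smul_smul, ← pow_add, add_comm]

theorem isoModSerre_powerTorsion_smul_id (X : C) :
    (powerTorsion C t).isoModSerre (t • 𝟙 X) := by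
  -- The witness `0` stands for the exponent `0 + 1`: `t` itself kills both kernel and cokernel.
  refine ⟨⟨0, ?_⟩, ⟨0, ?_⟩⟩
  · rw [← cancel_mono (kernel.ι (t • 𝟙 X)), zero_comp, zero_add, pow_one, Linear.smul_comp,
      Category.id_comp, ← kernel.condition (t • 𝟙 X), Linear.comp_smul, Category.comp_id]
  · rw [← cancel_epi (cokernel.π (t • 𝟙 X)), comp_zero, zero_add, pow_one, Linear.comp_smul,
      Category.comp_id, ← cokernel.condition (t • 𝟙 X), Linear.smul_comp, Category.id_comp]

/-- A scalar that kills the identity of the image kills `f`, since `f` factors through it. This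
gives injectivity up to `t`-power torsion of the map on Homs. -/
theorem exists_pow_smul_eq_zero_of_image {X Y : C} {f : X ⟶ Y}
    (hf : powerTorsion C t (Abelian.image f)) : ∃ n : ℕ, t ^ n • f = 0 := by
  obtain ⟨n, hn⟩ := hf
  refine ⟨n + 1, ?_⟩
  rw [← Abelian.image.fac f, ← Linear.smul_comp, ← Category.comp_id (Abelian.factorThruImage f),
    ← Linear.comp_smul, hn, comp_zero, zero_comp]

/-! ### Scalars acting on the Serre quotient. -/

variable {D : Type*} [Category* D] [Preadditive D] (L : C ⥤ D) [L.Additive]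
  [L.IsLocalization (powerTorsion C t).isoModSerre]

variable (t) in
/-- The action of the scalars on the Serre quotient by the `t`-power torsion objects. -/
noncomputable def serreQuotientCenter : A →+* CatCenter D :=
  (CatCenter.localizationRingHom L (powerTorsion C t).isoModSerre).comp (Linear.toCatCenter A C)

theorem serreQuotientCenter_app (a : A) (X : C) :
    (serreQuotientCenter t L a).app (L.obj X) = L.map (a • 𝟙 X) :=
  CatCenter.localization_app _ _ _ _

/-- On `L.obj X` the scalar `t` acts as `L.map (t • 𝟙 X)`, which `L` inverts; essential surjectivity
of `L` reaches all other objects. -/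
theorem isUnit_serreQuotientCenter : IsUnit (serreQuotientCenter t L t) := by
  have (Y : D) : IsIso ((serreQuotientCenter t L t).app Y) := by
    have := Localization.essSurj L (powerTorsion C t).isoModSerre
    have h : IsIso ((serreQuotientCenter t L t).app (L.obj (L.objPreimage Y))) := by
      rw [serreQuotientCenter_app]
      exact Localization.inverts L (powerTorsion C t).isoModSerre _
        (isoModSerre_powerTorsion_smul_id _)
    exact (NatTrans.isIso_app_iff_of_iso (serreQuotientCenter t L t)
      (L.objObjPreimageIso Y)).1 h
  have : IsIso (X := 𝟭 D) (Y := 𝟭 D) (serreQuotientCenter t L t) :=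
    NatIso.isIso_of_isIso_app _
  exact (isUnit_iff_isIso _).2 this

variable (t) (K : Type*) [CommRing K] [Algebra A K] [IsLocalization.Away t K]

/-- The action of `A[1/t]` on the Serre quotient by the `t`-power torsion objects. -/
noncomputable def serreQuotientAwayCenter : K →+* CatCenter D :=
  -- The centre of a category is commutative, as the universal property of `A[1/t]` requires of its
  -- target.
  letI : CommRing (CatCenter D) := { mul_comm := mul_comm' }
  IsLocalization.Away.lift (S := K) t (g := serreQuotientCenter t L) (isUnit_serreQuotientCenter L)

theorem serreQuotientAwayCenter_algebraMap (a : A) :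
    serreQuotientAwayCenter t L K (algebraMap A K a) = serreQuotientCenter t L a :=
  let : CommRing (CatCenter D) := { mul_comm := mul_comm' }
  IsLocalization.Away.lift_eq _ _ _

/-- The Serre quotient of an `A`-linear abelian category by the `t`-power torsion objects is
`A[1/t]`-linear. -/
@[reducible]
noncomputable def linearSerreQuotient : Linear K D :=
  Linear.ofRingMorphism (serreQuotientAwayCenter t L K)

theorem map_smul_serreQuotient {X Y : C} (a : A) (f : X ⟶ Y) :
    letI := linearSerreQuotient t L K
    L.map (a • f) = algebraMap A K a • L.map f := by
  -- By definition, a scalar acts on a morphism by precomposition with its central endomorphism of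
  -- the source.
  change _ = (serreQuotientAwayCenter t L K (algebraMap A K a)).app (L.obj X) ≫ L.map f
  rw [serreQuotientAwayCenter_algebraMap, serreQuotientCenter_app, ← L.map_comp,
    Linear.smul_comp, Category.id_comp]

/-! ### Hom groups of the quotient as localized modules. -/

/-- The morphisms of the Serre quotient by the `t`-power torsion objects are obtained from those
of the category by inverting `t`. -/
theorem exists_tensor_equiv_serreQuotient (X Y : C) :
    letI := linearSerreQuotient t L K
    ∃ e : (K ⊗[A] (X ⟶ Y)) ≃ₗ[K] (L.obj X ⟶ L.obj Y),
      ∀ (a : K) (f : X ⟶ Y), e (a ⊗ₜ[A] f) = a • L.map f := by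
  let := linearSerreQuotient t L K
  -- `A` acts through `K`, so compatibility of the two actions holds by `rfl`.
  let : Module A (L.obj X ⟶ L.obj Y) := Module.compHom _ (algebraMap A K)
  have : IsScalarTower A K (L.obj X ⟶ L.obj Y) := IsScalarTower.of_algebraMap_smul fun _ _ ↦ rfl
  let φ : (X ⟶ Y) →ₗ[A] (L.obj X ⟶ L.obj Y) :=
    { toFun f := L.map f
      map_add' _ _ := L.map_add
      map_smul' a f := map_smul_serreQuotient t L K a f }
  have hφ : IsLocalizedModule (Submonoid.powers t) φ :=
    { map_units := by
        rintro ⟨_, n, rfl⟩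
        rw [Module.End.isUnit_iff]
        have h := (IsLocalization.Away.algebraMap_isUnit (S := K) t).pow n
        rw [← map_pow] at h
        obtain ⟨u, hu⟩ := h
        have hu' (g : L.obj X ⟶ L.obj Y) : t ^ n • g = u • g := by
          rw [← algebraMap_smul K (t ^ n) g, ← hu]; rfl
        refine ⟨fun g h hgh ↦ ?_, fun g ↦ ⟨u⁻¹ • g, ?_⟩⟩
        · have hgh' : u • g = u • h := by rw [← hu', ← hu']; exact hgh
          exact smul_left_cancel u hgh'
        · exact (hu' _).trans (smul_inv_smul u g)
      surj := fun g ↦ by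
        -- Here `g` is `L.map z.f` followed by the inverse of `L.map z.s`. If `z.s ≫ r = t ^ n`,
        -- then `L.map (z.f ≫ r) = t ^ n • g`.
        obtain ⟨z, rfl⟩ := Localization.exists_leftFraction L (powerTorsion C t).isoModSerre g
        obtain ⟨r, n, hr, -⟩ := exists_comp_eq_pow_smul_id z.hs
        refine ⟨⟨z.f ≫ r, t ^ n, n, rfl⟩, ?_⟩
        have := Localization.inverts L _ _ z.hs
        change t ^ n • z.map L (Localization.inverts L _) = L.map (z.f ≫ r)
        rw [L.map_comp, ← z.map_comp_map_s L (Localization.inverts L _), Category.assoc,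
          ← L.map_comp, hr, map_smul_serreQuotient t L K, L.map_id, Linear.comp_smul,
          Category.comp_id]
        rfl
      exists_of_eq := fun {f g} hfg ↦ by
        -- `L` kills a morphism exactly when its image is torsion; this is applied to the
        -- difference.
        have h0 : L.map (f - g) = 0 := by rw [L.map_sub, sub_eq_zero]; exact hfg
        rw [ObjectProperty.SerreClassLocalization.map_eq_zero_iff L (powerTorsion C t)] at h0
        obtain ⟨n, hn⟩ := exists_pow_smul_eq_zero_of_image h0
        refine ⟨⟨t ^ n, n, rfl⟩, ?_⟩
        rwa [smul_sub, sub_eq_zero] at hn }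
  exact ⟨(IsLocalizedModule.isBaseChange (Submonoid.powers t) K φ).equiv,
    fun a f ↦ IsBaseChange.equiv_tmul _ a f⟩

end SerreQuotient

end FormalGenericFibre

theorem proposition2p3 {X : Scheme.{0}} (s : X ⟶ Spec (CommRingCat.of ℂ))
    (hX : FormalGenericFibre.IsSmoothProjectiveVariety s)
    (𝒳 : FormalGenericFibre.FormalDeformation s) :
    ∃ (_ : Abelian 𝒳.CohK) (_ : Linear FormalGenericFibre.BaseField 𝒳.CohK),
      𝒳.toCohK.Additive ∧
      (∀ (F G : 𝒳.Coh) (r : FormalGenericFibre.BaseRing) (f : F ⟶ G),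
        𝒳.toCohK.map (r • f) =
          algebraMap FormalGenericFibre.BaseRing FormalGenericFibre.BaseField r • 𝒳.toCohK.map f) ∧
      ∀ F G : 𝒳.Coh,
        ∃ e : (FormalGenericFibre.BaseField ⊗[FormalGenericFibre.BaseRing] (F ⟶ G))
            ≃ₗ[FormalGenericFibre.BaseField] (𝒳.toCohK.obj F ⟶ 𝒳.toCohK.obj G),
          ∀ (a : FormalGenericFibre.BaseField) (f : F ⟶ G),
            e (a ⊗ₜ[FormalGenericFibre.BaseRing] f) = a • 𝒳.toCohK.map f := by
  let P := FormalGenericFibre.powerTorsion 𝒳.Coh FormalGenericFibre.param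
  have : 𝒳.toCohK.IsLocalization P.isoModSerre :=
    inferInstanceAs (P.isoModSerre.Q.IsLocalization P.isoModSerre)
  let : Preadditive 𝒳.CohK := Localization.preadditive 𝒳.toCohK P.isoModSerre
  have : 𝒳.toCohK.Additive := Localization.functor_additive 𝒳.toCohK P.isoModSerre
  let : Abelian 𝒳.CohK := ObjectProperty.SerreClassLocalization.abelian 𝒳.toCohK P
  -- Laurent series are power series with `t` inverted, so `K` is `A[1/t]`.
  have : IsLocalization.Away FormalGenericFibre.param FormalGenericFibre.BaseField :=
    inferInstanceAs (IsLocalization (Submonoid.powers (PowerSeries.X : PowerSeries ℂ)) _)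
  exact ⟨inferInstance, FormalGenericFibre.linearSerreQuotient FormalGenericFibre.param 𝒳.toCohK _,
    inferInstance,
    fun _ _ ↦ FormalGenericFibre.map_smul_serreQuotient FormalGenericFibre.param 𝒳.toCohK _,
    FormalGenericFibre.exists_tensor_equiv_serreQuotient FormalGenericFibre.param 𝒳.toCohK _⟩
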